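/- **Problem.** Let $\mathcal X$ be a finite set of first-stage decisions and, for each $\mathbf x\in\mathcal X$, let $\mathcal Y(\mathbf x)$ be a finite nonempty set of second-stage decisions. Let $\Xi$ be the scenario set with distribution $F$, and write $q_{\mathbf x}(\mathbf y,\pmb\xi)=q(\mathbf x,\mathbf y,\pmb\xi)$. Consider $$\min_{\mathbf x\in\mathcal X}\; c_0(\mathbf x)+\mathrm E_{\pmb\xi}\Big[\min_{\mathbf y\in\mathcal Y(\mathbf x)}q(\mathbf x,\mathbf y,\pmb\xi)\Big].$$ **Models.** For each $\mathbf x$, the function $q_{\mathbf x}$ on $\mathcal Y(\mathbf x)\times\Xi$ is modelled by a Gaussian process with constant trend, variance $\sigma^2=\sigma^2_{\mathbf x}$ and correlation function $R_{\phi}$, where $\phi=\phi_{\mathbf x}$ (local model). The objective on $\mathcal X$ is modelled by a Gaussian process with constant trend, variance $\tau^2$ and correlation function $r_\psi$ (global model). All correlation functions are strictly positive definite with value $1$ on the diagonal, and $r_\psi$ is continuous in $\psi$. For a covariance matrix $A$ of the outputs $v$ at the design points, covariance vector $k$ and prior variance $c$ at the prediction point, put $\widehat\beta=(\mathbf 1'A^{-1}\mathbf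 1)^{-1}\mathbf 1'A^{-1}v$. The kriging mean and variance are $$\widehat\beta+k'A^{-1}(v-\widehat\beta\mathbf 1),\qquad c-k'A^{-1}k+(1-\mathbf 1'A^{-1}k)^2(\mathbf 1'A^{-1}\mathbf 1)^{-1}.$$ The local model at $\mathbf x$, with mean $\widehat q_{\mathbf x}$ and variance $s^2_{\mathbf x}$, uses the simulated points as design points, has no noise, and uses current estimates $\widehat\sigma^2,\widehat\phi$. The expected improvement (EI) of $\mathbf y$ for scenario $\pmb\xi_j$ with current estimated solution $\widehat{\mathbf y}_j$ is $\mathrm E[\max(q_{\mathbf x}(\widehat{\mathbf y}_j,\pmb\xi_j)-\widetilde q,0)]$ with $\widetilde q\sim N(\widehat q_{\mathbf x}(\mathbf y,\pmb\xi_j),s^2_{\mathbf x}(\mathbf y,\pmb\xi_j))$. **Procedure.** Fix $n_0\ge1$, $\alpha_0>0$, $g>1$, $s\ge 1$, $B\ge1$, $T\ge2$, a bound $\overline G>0$ and a variance floor $\sigma^2_{\min}>0$. The scenarios $\pmb\xi_{1},\pmb\xi_{2},\dots$ at the points $\mathbf x$ are i.i.d. with law $F$. Each iteration $k$ has a set $D^{(k)}\subseteq\mathcal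 X$ of visited points. The first one is nonempty, and each local model starts from a nonempty finite initial design. 1. *Second stage.* If $\mathbf x\in D^{(k)}$ is visited for the $t$-th time, its number of scenarios is raised to $N^{(k)}(\mathbf x)=\lceil n_0g^{t-1}\rceil$ and its threshold is $\alpha^{(k)}(\mathbf x)=\alpha_0g^{-(t-1)/2}$. For each new scenario, $\widehat{\mathbf y}_j$ is a minimizer of $\widehat q_{\mathbf x}(\cdot,\pmb\xi_j)$; the point $(\widehat{\mathbf y}_j,\pmb\xi_j)$ may or may not be added to the design points. All $N^{(k)}(\mathbf x)$ scenarios are then declared unfinished. As long as there are unfinished scenarios, one of them, $j$, is taken up and a maximizer $\mathbf y$ of the EI for $\pmb\xi_j$ is found. If its EI is at most $\alpha^{(k)}(\mathbf x)\,|q_{\mathbf x}(\widehat{\mathbf y}_j,\pmb\xi_j)|$, scenario $j$ is finished for this iteration. Otherwise $(\mathbf y,\pmb\xi_j)$ is simulated and added to the design points, and $\widehat{\mathbf y}_j$ is replaced by $\mathbf y$ if $\mathbf y$ is better. The iteration ends when all scenarios at all $\mathbf x\in D^{(k)}$ are finished. Nothing changes at $\mathbf x\notin D^{(k)}$. 2.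 *Objective estimates.* At each point $\mathbf x$ visited so far, the expected gap of scenario $j$ is estimated by $$\widehat{\mathrm E}_j=\frac1B\sum_{b=1}^B\max\Big(0,\;q_{\mathbf x}(\widehat{\mathbf y}_j,\pmb\xi_j)-\min_{\mathbf y}\widetilde q^{(b)}_{\mathbf x}(\mathbf y,\pmb\xi_j)\Big)$$ from sample paths $\widetilde q^{(b)}_{\mathbf x}$. Then $\bar G(\mathbf x)$ is the average over $j\le N^{(k)}(\mathbf x)$ of $c_0(\mathbf x)+q_{\mathbf x}(\widehat{\mathbf y}_j,\pmb\xi_j)-\widehat{\mathrm E}_j$, truncated to $[-\overline G,\overline G]$. Its variance is estimated by the sample variance of $T$ bootstrap means of these outputs. 3. *First stage.* The global kriging model, with estimates $\widehat\tau^2,\widehat\psi$, is fitted to the values $\bar G$ at the points visited so far, with these variances added to the diagonal of the covariance matrix. Its variance is raised to at least $\sigma_{\min}^2$ at visited points. With $\widetilde G(\mathbf x)$ normal with the resulting mean and variance, the next set $D^{(k+1)}$ consists of $s$ points which, given the history, are drawn independently from the distribution proportional to $\Pr\{\widetilde G(\mathbf x)<\min\bar G\}$, the minimum being over the points visited so far.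 The initial designs, the sample paths, the bootstrap resamples and the parameter estimates may be arbitrary random quantities; in particular, the sample paths may be drawn from the local posterior and the estimates may be maximum likelihood estimates. **Assumptions.** 1. There is $\overline M<\infty$ with $|c_0(\mathbf x)+q(\mathbf x,\mathbf y,\pmb\xi)|\le\overline M$ for all $\mathbf x,\mathbf y,\pmb\xi$. Moreover, for every $\mathbf x$ and every $\phi'$ in a neighbourhood of the true $\phi$ in the parameter space (which is just $\phi'=\phi$ if $\phi$ is known), $q_{\mathbf x}$ lies in the reproducing kernel Hilbert space of $R_{\phi'}$ on $\mathcal Y(\mathbf x)\times\Xi$ with norm at most $\overline M$. 2. $\mathcal X$ and all $\mathcal Y(\mathbf x)$ are finite. 3. $\sigma^2>0$ and $\tau^2>0$. 4. The estimates are consistent: w.p.1, as $k\to\infty$, the estimates $\widehat\sigma^2,\widehat\phi$ used in iteration $k$ (uniformly over the search steps of that iteration) and $\widehat\tau^2,\widehat\psi$ converge to the true values. **Conclusion.** Let $\widehat{\mathbf y}^{(k)}_j$ be the estimated solution for scenario $\pmb\xi_j$ at $\mathbf x$ after $k$ iterations and $$\delta^{(k)}(\mathbf x,\pmb\xi_j)=q_{\mathbf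 x}(\widehat{\mathbf y}^{(k)}_j,\pmb\xi_j)-\min_{\mathbf y\in\mathcal Y(\mathbf x)}q_{\mathbf x}(\mathbf y,\pmb\xi_j).$$ Then for every $\mathbf x\in\mathcal X$, w.p.1, every scenario $\pmb\xi_j$ is eventually among the $N^{(k)}(\mathbf x)$ generated ones and $\delta^{(k)}(\mathbf x,\pmb\xi_j)\to0$ as $k\to\infty$. The convergence is uniform over the generated scenarios: for every $\varepsilon>0$, for all large $k$, $\delta^{(k)}(\mathbf x,\pmb\xi_j)<\varepsilon$ for all $j\le N^{(k)}(\mathbf x)$. -/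

import Mathlib

open MeasureTheory ProbabilityTheory Filter Matrix
open scoped Topology

noncomputable section

namespace TwoStage

/-! ### Kriging (Gaussian process regression with an estimated constant trend) -/

/-- Generalized least squares estimate of a constant trend from outputs `v` with covariance
matrix `A`: `(1' A⁻¹ 1)⁻¹ 1' A⁻¹ v`. -/
def glsMean {ι : Type*} [Fintype ι] [DecidableEq ι] (A : Matrix ι ι ℝ) (v : ι → ℝ) : ℝ :=
  (1 ⬝ᵥ (A⁻¹ *ᵥ v)) / (1 ⬝ᵥ (A⁻¹ *ᵥ (1 : ι → ℝ)))

/-- Kriging predictor `β + k' A⁻¹ (v - β 1)`, where `β = glsMean A v` and `k` is the vector of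
covariances between the prediction point and the design points. -/
def krigingMean {ι : Type*} [Fintype ι] [DecidableEq ι] (A : Matrix ι ι ℝ) (k v : ι → ℝ) : ℝ :=
  glsMean A v + k ⬝ᵥ (A⁻¹ *ᵥ (v - fun _ => glsMean A v))

/-- Kriging variance `c - k' A⁻¹ k + η² (1' A⁻¹ 1)⁻¹`, `η = 1 - 1' A⁻¹ k`, where `c` is the prior
variance at the prediction point. -/
def krigingVar {ι : Type*} [Fintype ι] [DecidableEq ι] (A : Matrix ι ι ℝ) (k : ι → ℝ) (c : ℝ) :
    ℝ :=
  c - k ⬝ᵥ (A⁻¹ *ᵥ k)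
    + (1 - 1 ⬝ᵥ (A⁻¹ *ᵥ k)) ^ 2 / (1 ⬝ᵥ (A⁻¹ *ᵥ (1 : ι → ℝ)))

/-- `K` is a (strictly positive definite) correlation function on `Z`. -/
structure IsCorrelation {Z : Type*} (K : Z → Z → ℝ) : Prop where
  diag : ∀ z, K z z = 1
  symm : ∀ z z', K z z' = K z' z
  posDef : ∀ P : Finset Z, (Matrix.of fun a b : P => K a b).PosDef

/-- `f` belongs to the reproducing kernel Hilbert space of the kernel `K` and has norm at most `M`
there. -/
def RKHSNormLE.{u} {Z : Type u} (K : Z → Z → ℝ) (f : Z → ℝ) (M : ℝ) : Prop :=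
  ∃ (H : Type u) (_ : NormedAddCommGroup H) (_ : InnerProductSpace ℝ H) (_ : CompleteSpace H)
    (_ : RKHS ℝ H Z ℝ),
    (∀ z z', RKHS.kernel H z z' 1 = K z z') ∧ ∃ h : H, (∀ z, h z = f z) ∧ ‖h‖ ≤ M

open scoped Classical in
/-- Predictor at `z` of the noiseless kriging model of `f` with correlation function `K` and
design points `P`. -/
def localMean {Z : Type*} (K : Z → Z → ℝ) (f : Z → ℝ) (P : Finset Z) (z : Z) : ℝ :=
  krigingMean (Matrix.of fun a b : P => K a b) (fun a : P => K z a) (fun a : P => f a)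

open scoped Classical in
/-- Predictive variance at `z` of the noiseless kriging model with process variance `σ2`,
correlation function `K` and design points `P`. -/
def localVar {Z : Type*} (σ2 : ℝ) (K : Z → Z → ℝ) (P : Finset Z) (z : Z) : ℝ :=
  σ2 * krigingVar (Matrix.of fun a b : P => K a b) (fun a : P => K z a) (K z z)

/-- Expected improvement `E[max (best - t, 0)]` for `t ∼ N(m, v)`. -/
def expectedImprovement (best m v : ℝ) : ℝ :=
  ∫ t, max (best - t) 0 ∂(gaussianReal m v.toNNReal)

/-! ### The two-stage problem, the models and the parameters of the procedure -/

/-- The two-stage problem `min_x c0 x + E_ξ [min_{y ∈ Y x} q x y ξ]`. The first-stage feasible set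
is `X`, the second-stage feasible set at `x` is `Y x`, the scenario set is `Ξ`. -/
structure Problem (X : Type*) (Y : X → Type*) (Ξ : Type*) [MeasurableSpace Ξ] where
  c0 : X → ℝ
  q : (x : X) → Y x → Ξ → ℝ
  /-- the distribution of the scenarios -/
  F : Measure Ξ

/-- The prior Gaussian process models. At each `x`, the local model of `q x` on `Y x × Ξ` has
process variance `σ2 x` and correlation function `R x (φ x)`; the global model on `X` has process
variance `τ2` and correlation function `r ψ`. The parameters `φ x` and `ψ` are the true elements
of the parameter spaces `Φ` and `Ψ`. -/
structure Models (X : Type*) (Y : X → Type*) (Ξ : Type*) (Φ Ψ : Type*)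
    [TopologicalSpace Φ] [TopologicalSpace Ψ] where
  R : (x : X) → Φ → (Y x × Ξ) → (Y x × Ξ) → ℝ
  σ2 : X → ℝ
  φ : X → Φ
  r : Ψ → X → X → ℝ
  τ2 : ℝ
  ψ : Ψ
  isCorrelation_R : ∀ x θ, IsCorrelation (R x θ)
  isCorrelation_r : ∀ θ, IsCorrelation (r θ)
  continuous_r : ∀ x x', Continuous fun θ => r θ x x'

/-- Parameters of the procedure. -/
structure Config where
  /-- number of scenarios at the first visit -/
  n0 : ℕ
  /-- initial relative EI threshold -/
  α0 : ℝ
  /-- growth factor -/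
  g : ℝ
  /-- number of first-stage points drawn per iteration -/
  s : ℕ
  /-- number of posterior sample paths in the estimate of the optimality gap -/
  B : ℕ
  /-- number of bootstrap replications -/
  T : ℕ
  /-- predetermined bound on the objective estimates -/
  Gmax : ℝ
  /-- variance floor at the visited first-stage points -/
  varMin : ℝ
  n0_pos : 0 < n0
  α0_pos : 0 < α0
  one_lt_g : 1 < g
  s_pos : 0 < s
  B_pos : 0 < B
  two_le_T : 2 ≤ T
  Gmax_pos : 0 < Gmax
  varMin_pos : 0 < varMin

/-- Accumulated number of scenarios at a point visited `t` times: `⌈n0 g^(t-1)⌉`, and `0` if the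
point has not been visited. -/
def Config.numScenarios (cfg : Config) (t : ℕ) : ℕ :=
  if t = 0 then 0 else ⌈(cfg.n0 : ℝ) * cfg.g ^ (t - 1)⌉₊

/-- Relative EI threshold at the `t`-th visit: `α0 g^(-(t-1)/2)`. -/
def Config.threshold (cfg : Config) (t : ℕ) : ℝ :=
  cfg.α0 * cfg.g ^ (-(((t : ℝ) - 1) / 2))

/-! ### Second-stage search at one first-stage point -/

/-- State of the second-stage search at one first-stage point. Scenarios are numbered by `ℕ`. -/
structure LocalState (Yx Ξ : Type*) where
  /-- simulated points, i.e. the design points of the local metamodel -/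
  design : Finset (Yx × Ξ)
  /-- current estimated optimal second-stage decision for each scenario -/
  incumbent : ℕ → Yx
  /-- scenarios whose search has been terminated in the present iteration -/
  finished : Finset ℕ

/-- Expected improvement at decision `y` for scenario `j` in state `S`, when the local model has
process variance `σ2` and correlation function `K`. -/
def LocalState.EI {Yx Ξ : Type*} (S : LocalState Yx Ξ) (f : Yx → Ξ → ℝ) (ξ : ℕ → Ξ)
    (σ2 : ℝ) (K : Yx × Ξ → Yx × Ξ → ℝ) (j : ℕ) (y : Yx) : ℝ :=
  expectedImprovement (f (S.incumbent j) (ξ j))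
    (localMean K (fun z => f z.1 z.2) S.design (y, ξ j))
    (localVar σ2 K S.design (y, ξ j))

open scoped Classical in
/-- One step of the search: an unfinished scenario `j < N` is taken up and the point `y` of maximal
expected improvement is determined. If its EI relative to `|q(incumbent)|` is at most `α`, the
search for `j` is terminated. Otherwise `(y, ξ j)` is simulated, it is added to the design points,
and it becomes the incumbent if it is better than the present one. -/
def SearchStep {Yx Ξ : Type*} (f : Yx → Ξ → ℝ) (ξ : ℕ → Ξ) (N : ℕ) (α σ2 : ℝ)
    (K : Yx × Ξ → Yx × Ξ → ℝ) (S S' : LocalState Yx Ξ) : Prop :=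
  ∃ j < N, j ∉ S.finished ∧ ∃ y, (∀ y', S.EI f ξ σ2 K j y' ≤ S.EI f ξ σ2 K j y) ∧
    ((S.EI f ξ σ2 K j y ≤ α * |f (S.incumbent j) (ξ j)| ∧
        S' = { S with finished := insert j S.finished }) ∨
     (α * |f (S.incumbent j) (ξ j)| < S.EI f ξ σ2 K j y ∧
        S' = { S with
          design := insert (y, ξ j) S.design
          incumbent := Function.update S.incumbent j
            (if f y (ξ j) < f (S.incumbent j) (ξ j) then y else S.incumbent j) }))

open scoped Classical in
/-- A complete second-stage search leading from `S` to `S'`, in which the number of scenarios grows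
from `Nold` to `Nnew` and the threshold is `α`. At the `m`-th step the local metamodel uses the
process variance `σ2 m` and the correlation function `K m`.

The collection of finished scenarios is reset and the incumbents of the old scenarios are kept. The
first incumbent of a new scenario minimizes the predictor of the local metamodel. Since its response
is evaluated, it may or may not be added to the design points. Then search steps are
made until all scenarios are finished. -/
def SecondStageSearch {Yx Ξ : Type*} (f : Yx → Ξ → ℝ) (ξ : ℕ → Ξ) (Nold Nnew : ℕ) (α : ℝ)
    (σ2 : ℕ → ℝ) (K : ℕ → Yx × Ξ → Yx × Ξ → ℝ) (S S' : LocalState Yx Ξ) : Prop :=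
  ∃ (L : ℕ) (tr : ℕ → LocalState Yx Ξ),
    (tr 0).finished = ∅ ∧
    (∀ j < Nold, (tr 0).incumbent j = S.incumbent j) ∧
    (∀ j, Nold ≤ j → j < Nnew → ∀ y,
      localMean (K 0) (fun z => f z.1 z.2) S.design ((tr 0).incumbent j, ξ j)
        ≤ localMean (K 0) (fun z => f z.1 z.2) S.design (y, ξ j)) ∧
    S.design ⊆ (tr 0).design ∧
    (tr 0).design ⊆
      S.design ∪ (Finset.Ico Nold Nnew).image (fun j => ((tr 0).incumbent j, ξ j)) ∧
    (∀ m < L, SearchStep f ξ Nnew α (σ2 m) (K m) (tr m) (tr (m + 1))) ∧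
    (tr L).finished = Finset.range Nnew ∧
    S' = tr L

/-! ### The whole procedure -/

/-- The random quantities occurring in an execution of the procedure on the sample space `Ω`. The
iterations are numbered `0, 1, 2, …`. -/
structure RunData (X : Type*) (Y : X → Type*) (Ξ : Type*) (Φ Ψ : Type*) (cfg : Config)
    (Ω : Type*) where
  /-- first-stage points visited in iteration `k` -/
  D : ℕ → Ω → Finset X
  /-- scenario number `j` at `x` -/
  ξ : (x : X) → ℕ → Ω → Ξ
  /-- state of the local search at `x` before iteration `k`, i.e. after `k` iterations; at `k = 0`
  its design points are the initial design of the local metamodel -/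
  loc : ℕ → (x : X) → Ω → LocalState (Y x) Ξ
  /-- estimate of the local process variance used in step `m` of the search at `x` in
  iteration `k` -/
  σ2hat : ℕ → X → ℕ → Ω → ℝ
  /-- estimate of the local correlation parameter used in step `m` of the search at `x` in
  iteration `k` -/
  φhat : ℕ → X → ℕ → Ω → Φ
  /-- value at `y` for scenario `j` of the `b`-th sample path of the local metamodel at `x`, as
  used in the gap estimates available after iteration `k` -/
  path : ℕ → (x : X) → ℕ → Fin cfg.B → Ω → Y x → ℝ
  /-- index of the `l`-th output in the `t`-th bootstrap sample at `x`, after iteration `k` -/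
  resample : ℕ → X → Fin cfg.T → ℕ → Ω → ℕ
  /-- estimate of the global process variance after iteration `k` -/
  τ2hat : ℕ → Ω → ℝ
  /-- estimate of the global correlation parameter after iteration `k` -/
  ψhat : ℕ → Ω → Ψ
  /-- the first-stage points drawn after iteration `k` -/
  draw : ℕ → Fin cfg.s → Ω → X

namespace RunData

variable {X : Type*} {Y : X → Type*} {Ξ : Type*} [MeasurableSpace Ξ] {Φ Ψ : Type*}
  [TopologicalSpace Φ] [TopologicalSpace Ψ] {cfg : Config} {Ω : Type*}

open scoped Classical in
/-- Number of visits to `x` in the first `k` iterations. -/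
def visits (A : RunData X Y Ξ Φ Ψ cfg Ω) (k : ℕ) (x : X) (ω : Ω) : ℕ :=
  ((Finset.range k).filter fun i => x ∈ A.D i ω).card

/-- Number of scenarios at `x` after `k` iterations. -/
def N (A : RunData X Y Ξ Φ Ψ cfg Ω) (k : ℕ) (x : X) (ω : Ω) : ℕ :=
  cfg.numScenarios (A.visits k x ω)

/-- Optimality gap for scenario `j` at `x` after `k` iterations. -/
def gap (A : RunData X Y Ξ Φ Ψ cfg Ω) (p : Problem X Y Ξ) (k : ℕ) (x : X) (j : ℕ) (ω : Ω) : ℝ :=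
  p.q x ((A.loc k x ω).incumbent j) (A.ξ x j ω) - ⨅ y, p.q x y (A.ξ x j ω)

/-- First-stage points visited in the first `k` iterations. -/
def visited [Fintype X] (A : RunData X Y Ξ Φ Ψ cfg Ω) (k : ℕ) (ω : Ω) : Finset X :=
  Finset.univ.filter fun x => 0 < A.visits k x ω

/-- Monte Carlo estimate of the expected optimality gap for scenario `j` at `x` after iteration
`k`. -/
def gapEstimate (A : RunData X Y Ξ Φ Ψ cfg Ω) (p : Problem X Y Ξ) (k : ℕ) (x : X) (j : ℕ)
    (ω : Ω) : ℝ :=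
  (∑ b, max 0 (p.q x ((A.loc (k + 1) x ω).incumbent j) (A.ξ x j ω) - ⨅ y, A.path k x j b ω y))
    / cfg.B

/-- Gap-adjusted output of scenario `j` at `x` after iteration `k`. -/
def output (A : RunData X Y Ξ Φ Ψ cfg Ω) (p : Problem X Y Ξ) (k : ℕ) (x : X) (j : ℕ)
    (ω : Ω) : ℝ :=
  p.c0 x + p.q x ((A.loc (k + 1) x ω).incumbent j) (A.ξ x j ω) - A.gapEstimate p k x j ω

/-- Estimate of the objective at `x` after iteration `k`: the average of the gap-adjusted outputs,
truncated at the predetermined bound. -/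
def Gbar (A : RunData X Y Ξ Φ Ψ cfg Ω) (p : Problem X Y Ξ) (k : ℕ) (x : X) (ω : Ω) : ℝ :=
  max (-cfg.Gmax) (min cfg.Gmax
    ((∑ j ∈ Finset.range (A.N (k + 1) x ω), A.output p k x j ω) / A.N (k + 1) x ω))

/-- Mean of the `t`-th bootstrap sample. -/
def bootMean (A : RunData X Y Ξ Φ Ψ cfg Ω) (p : Problem X Y Ξ) (k : ℕ) (x : X) (t : Fin cfg.T)
    (ω : Ω) : ℝ :=
  (∑ l ∈ Finset.range (A.N (k + 1) x ω), A.output p k x (A.resample k x t l ω) ω)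
    / A.N (k + 1) x ω

/-- Bootstrap estimate of the variance of the objective estimate: sample variance of the bootstrap
means. -/
def V (A : RunData X Y Ξ Φ Ψ cfg Ω) (p : Problem X Y Ξ) (k : ℕ) (x : X) (ω : Ω) : ℝ :=
  (∑ t, (A.bootMean p k x t ω - (∑ t', A.bootMean p k x t' ω) / cfg.T) ^ 2) / ((cfg.T : ℝ) - 1)

open scoped Classical in
/-- Covariance matrix (process plus estimation error) of the global metamodel after iteration
`k`. -/
def globalCov [Fintype X] (A : RunData X Y Ξ Φ Ψ cfg Ω) (p : Problem X Y Ξ)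
    (M : Models X Y Ξ Φ Ψ) (k : ℕ) (ω : Ω) :
    Matrix (A.visited (k + 1) ω) (A.visited (k + 1) ω) ℝ :=
  (Matrix.of fun a b : A.visited (k + 1) ω => A.τ2hat k ω * M.r (A.ψhat k ω) a b)
    + Matrix.diagonal fun a : A.visited (k + 1) ω => A.V p k a ω

open scoped Classical in
/-- Predictor of the global metamodel after iteration `k`. -/
def globalMean [Fintype X] (A : RunData X Y Ξ Φ Ψ cfg Ω) (p : Problem X Y Ξ)
    (M : Models X Y Ξ Φ Ψ) (k : ℕ) (ω : Ω) (x : X) : ℝ :=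
  krigingMean (A.globalCov p M k ω) (fun a => A.τ2hat k ω * M.r (A.ψhat k ω) x a)
    (fun a => A.Gbar p k a ω)

open scoped Classical in
/-- Variance of the global metamodel after iteration `k`, with the floor `varMin` at the visited
points. -/
def globalVar [Fintype X] (A : RunData X Y Ξ Φ Ψ cfg Ω) (p : Problem X Y Ξ)
    (M : Models X Y Ξ Φ Ψ) (k : ℕ) (ω : Ω) (x : X) : ℝ :=
  let v := krigingVar (A.globalCov p M k ω)
    (fun a => A.τ2hat k ω * M.r (A.ψhat k ω) x a) (A.τ2hat k ω)
  if x ∈ A.visited (k + 1) ω then max v cfg.varMin else v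

/-- Objective estimate of the best visited point after iteration `k`. -/
def bestGbar [Fintype X] (A : RunData X Y Ξ Φ Ψ cfg Ω) (p : Problem X Y Ξ) (k : ℕ) (ω : Ω) : ℝ :=
  ⨅ a : A.visited (k + 1) ω, A.Gbar p k a ω

/-- Posterior probability that `x` is better than the best visited point, after iteration `k`. -/
def probBetter [Fintype X] (A : RunData X Y Ξ Φ Ψ cfg Ω) (p : Problem X Y Ξ)
    (M : Models X Y Ξ Φ Ψ) (k : ℕ) (ω : Ω) (x : X) : ℝ :=
  (gaussianReal (A.globalMean p M k ω x) (A.globalVar p M k ω x).toNNReal).real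
    (Set.Iio (A.bestGbar p k ω))

/-- Sampling distribution constructed after iteration `k`. -/
def samplingDist [Fintype X] (A : RunData X Y Ξ Φ Ψ cfg Ω) (p : Problem X Y Ξ)
    (M : Models X Y Ξ Φ Ψ) (k : ℕ) (ω : Ω) (x : X) : ℝ :=
  A.probBetter p M k ω x / ∑ x', A.probBetter p M k ω x'

open scoped Classical in
/-- `A` is an execution of the procedure on the problem `p` with the models `M`. The sample paths
`A.path`, the bootstrap indices, the initial designs and the parameter estimates may be any random
quantities, whatever their law. The filtration `𝓕` describes the history: `𝓕 k` is the information
available after iteration `k`. -/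
structure IsRun [Fintype X] {mΩ : MeasurableSpace Ω} (A : RunData X Y Ξ Φ Ψ cfg Ω)
    (p : Problem X Y Ξ) (M : Models X Y Ξ Φ Ψ) (μ : Measure Ω)
    (𝓕 : Filtration ℕ mΩ) : Prop where
  /-- the scenarios are i.i.d. with law `F` -/
  measurable_ξ : ∀ x j, Measurable (A.ξ x j)
  law_ξ : ∀ x j, μ.map (A.ξ x j) = p.F
  indep_ξ : iIndepFun (fun i : X × ℕ => A.ξ i.1 i.2) μ
  /-- the initial first-stage design and the initial local designs are nonempty -/
  D_zero : ∀ ω, (A.D 0 ω).Nonempty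
  loc_zero : ∀ x ω, (A.loc 0 x ω).design.Nonempty
  /-- second-stage optimization at the points visited in iteration `k` -/
  search : ∀ k ω, ∀ x ∈ A.D k ω,
    SecondStageSearch (p.q x) (fun j => A.ξ x j ω) (A.N k x ω) (A.N (k + 1) x ω)
      (cfg.threshold (A.visits (k + 1) x ω)) (fun m => A.σ2hat k x m ω)
      (fun m => M.R x (A.φhat k x m ω)) (A.loc k x ω) (A.loc (k + 1) x ω)
  /-- nothing happens at the other points -/
  loc_succ : ∀ k ω x, x ∉ A.D k ω → A.loc (k + 1) x ω = A.loc k x ω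
  /-- bootstrap samples are taken from the available outputs -/
  resample_lt : ∀ k x t l ω, l < A.N (k + 1) x ω → A.resample k x t l ω < A.N (k + 1) x ω
  /-- the next first-stage design consists of `s` points drawn independently from the sampling
  distribution, given the history -/
  measurable_draw : ∀ k i x, MeasurableSet[𝓕 (k + 1)] {ω | A.draw k i ω = x}
  law_draw : ∀ k (v : Fin cfg.s → X),
    μ[{ω | ∀ i, A.draw k i ω = v i}.indicator (fun _ => (1 : ℝ)) | 𝓕 k]
      =ᵐ[μ] fun ω => ∏ i, A.samplingDist p M k ω (v i)
  D_succ : ∀ k ω, A.D (k + 1) ω = Finset.univ.image fun i => A.draw k i ω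

end RunData

end TwoStage

end

/-! The argument has two independent halves, joined pathwise.

At a point visited infinitely often the gaps vanish. By Cauchy–Schwarz in the RKHS, the error of the
local predictor is at most a constant times its standard deviation
(`RKHSNormLE.abs_sub_localMean_le`). So if an incumbent is worse than some decision by `ε`, the EI
of that decision is at least `ε` times a fixed normal tail probability, however small the predictive
variance is (`expectedImprovement_ge`). A finished scenario has EI at most threshold times a bound
on `|q|`, and the threshold tends to `0` with the number of visits; hence no gap of size `ε`
survives (`SecondStageSearch.gap_lt`). The design points need not fill the space.

Every point is visited infinitely often. Near the true parameter the global correlation forms are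
uniformly positive definite. This bounds the global predictor, and keeps its variance away from `0`
at unvisited points, whatever the bootstrap variances are (`abs_krigingMean_le_and_krigingVar_ge`);
at visited points the floor does so. The sampling probabilities are therefore eventually bounded
below, and the conditional Borel–Cantelli lemma applies (`IsRun.ae_frequently_mem_D`). -/

namespace TwoStage

/-! ### Kriging as a constrained least squares problem. -/

section Kriging

variable {ι : Type*} [Fintype ι] [DecidableEq ι]

theorem _root_.Matrix.PosDef.dotProduct_inv_mulVec_comm {A : Matrix ι ι ℝ} (hA : A.PosDef)
    (u v : ι → ℝ) : u ⬝ᵥ (A⁻¹ *ᵥ v) = v ⬝ᵥ (A⁻¹ *ᵥ u) := by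
  have h : (A⁻¹)ᵀ = A⁻¹ := by
    simpa using hA.inv.isHermitian.eq
  rw [dotProduct_mulVec, ← mulVec_transpose, h, dotProduct_comm]

/-- Among all weights `w` with sum `1`, the kriging weights minimize the mean squared error
`c - 2 w'k + w'Aw` of the linear predictor `w'v`, and the minimum is the kriging variance. -/
theorem exists_krigingWeights [Nonempty ι] {A : Matrix ι ι ℝ} (hA : A.PosDef) (k : ι → ℝ) :
    ∃ w : ι → ℝ, 1 ⬝ᵥ w = 1 ∧ (∀ v, krigingMean A k v = w ⬝ᵥ v) ∧
      (∀ c, krigingVar A k c = c - 2 * (w ⬝ᵥ k) + w ⬝ᵥ (A *ᵥ w)) ∧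
      ∀ c w', 1 ⬝ᵥ w' = 1 → krigingVar A k c ≤ c - 2 * (w' ⬝ᵥ k) + w' ⬝ᵥ (A *ᵥ w') := by
  have hdet : IsUnit A.det := (Matrix.isUnit_iff_isUnit_det A).1 hA.isUnit
  have hs : 0 < (1 : ι → ℝ) ⬝ᵥ (A⁻¹ *ᵥ (1 : ι → ℝ)) := by
    have := hA.inv.dotProduct_mulVec_pos (x := (1 : ι → ℝ)) one_ne_zero
    simpa using this
  set s := (1 : ι → ℝ) ⬝ᵥ (A⁻¹ *ᵥ (1 : ι → ℝ)) with hsdef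
  set η := 1 - (1 : ι → ℝ) ⬝ᵥ (A⁻¹ *ᵥ k) with hη
  -- Lagrange condition: `A w - k` is a multiple of `1`, and the constraint `1'w = 1` fixes the
  -- multiplier `η / s`.
  set w := A⁻¹ *ᵥ k + (η / s) • (A⁻¹ *ᵥ (1 : ι → ℝ)) with hw
  have hw1 : 1 ⬝ᵥ w = 1 := by
    rw [hw, dotProduct_add, dotProduct_smul, ← hsdef, smul_eq_mul, div_mul_cancel₀ _ hs.ne', hη]
    ring
  have hAw : A *ᵥ w = k + (η / s) • (1 : ι → ℝ) := by
    rw [hw, mulVec_add, mulVec_smul, mulVec_mulVec, mulVec_mulVec, Matrix.mul_nonsing_inv _ hdet,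
      one_mulVec, one_mulVec]
  have hwk : w ⬝ᵥ k = k ⬝ᵥ (A⁻¹ *ᵥ k) + (η / s) * (1 - η) := by
    rw [dotProduct_comm, hw, dotProduct_add, dotProduct_smul,
      hA.dotProduct_inv_mulVec_comm k 1, smul_eq_mul, hη]
    ring
  have hvar : ∀ c, krigingVar A k c = c - 2 * (w ⬝ᵥ k) + w ⬝ᵥ (A *ᵥ w) := by
    intro c
    rw [hAw, dotProduct_add, dotProduct_smul, dotProduct_comm w 1, hw1, hwk, krigingVar, ← hsdef,
      ← hη, smul_eq_mul]
    field_simp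
    ring
  refine ⟨w, hw1, fun v => ?_, hvar, fun c w' hw' => ?_⟩
  · have h1 : w ⬝ᵥ v = k ⬝ᵥ (A⁻¹ *ᵥ v) + (η / s) * (1 ⬝ᵥ (A⁻¹ *ᵥ v)) := by
      rw [dotProduct_comm, hw, dotProduct_add, dotProduct_smul,
        hA.dotProduct_inv_mulVec_comm v, hA.dotProduct_inv_mulVec_comm v, smul_eq_mul]
    have h2 : (v - fun _ => glsMean A v) = v - glsMean A v • (1 : ι → ℝ) := by
      ext; simp
    rw [krigingMean, h1, h2, mulVec_sub, mulVec_smul, dotProduct_sub, dotProduct_smul,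
      hA.dotProduct_inv_mulVec_comm k 1, smul_eq_mul, glsMean, ← hsdef, hη]
    field_simp
    ring
  -- The error of `w'` exceeds that of `w` by exactly this square: the cross term vanishes because
  -- `A w - k` is parallel to `1` and `1'(w' - w) = 0`.
  · have h1 : 0 ≤ (w' - w) ⬝ᵥ (A *ᵥ (w' - w)) := by
      simpa using hA.posSemidef.dotProduct_mulVec_nonneg (w' - w)
    have h2 : w ⬝ᵥ (A *ᵥ w') = w' ⬝ᵥ (A *ᵥ w) := by
      have h : Aᵀ = A := by simpa using hA.isHermitian.eq
      rw [dotProduct_mulVec, ← mulVec_transpose, h, dotProduct_comm]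
    have h3 : w' ⬝ᵥ (A *ᵥ w) = w' ⬝ᵥ k + η / s := by
      rw [hAw, dotProduct_add, dotProduct_smul, dotProduct_comm w' 1, hw']
      simp
    have h4 : w ⬝ᵥ (A *ᵥ w) = w ⬝ᵥ k + η / s := by
      rw [hAw, dotProduct_add, dotProduct_smul, dotProduct_comm w 1, hw1]
      simp
    rw [mulVec_sub, dotProduct_sub, sub_dotProduct, sub_dotProduct] at h1
    rw [hvar]
    linarith

end Kriging

/-! ### Gaussian tail bounds, including zero variance. -/

section Gaussian

/-- The probability of the half-line up to `z` standard deviations above the mean. -/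
theorem gaussianReal_Iic_ge (m : ℝ) {v : ℝ} (hv : 0 ≤ v) (z : ℝ) :
    (gaussianReal 0 1).real (Set.Iic z) ≤
      (gaussianReal m v.toNNReal).real (Set.Iic (m + √v * z)) := by
  -- The affine image of the standard normal law covers `v = 0` as well, where both sides are a
  -- Dirac mass.
  have h : gaussianReal m v.toNNReal = (gaussianReal 0 1).map (fun t => m + √v * t) := by
    have h1 := gaussianReal_map_const_mul (μ := 0) (v := 1) (√v)
    have h2 := gaussianReal_map_const_add (μ := √v * 0) (v := v.toNNReal) m
    have h3 : NNReal.mk (√v ^ 2) (sq_nonneg _) * 1 = v.toNNReal := by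
      ext; simp [Real.sq_sqrt hv, Real.coe_toNNReal _ hv]
    rw [h3] at h1
    rw [← h1, Measure.map_map (by fun_prop) (by fun_prop)] at h2
    rw [show (fun t => m + √v * t) = (fun x => m + x) ∘ (fun x => √v * x) from rfl, h2]
    simp
  rw [h, map_measureReal_apply (by fun_prop) measurableSet_Iic]
  refine measureReal_mono fun t ht => ?_
  simp only [Set.mem_preimage, Set.mem_Iic] at ht ⊢
  gcongr

theorem gaussianReal_Iic_pos (z : ℝ) : 0 < (gaussianReal 0 1).real (Set.Iic z) := by
  refine ENNReal.toReal_pos (fun h => ?_) (measure_ne_top _ _)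
  have := gaussianReal_absolutelyContinuous' 0 (v := 1) one_ne_zero h
  simp at this

theorem integrable_improvement (best m : ℝ) (v : NNReal) :
    Integrable (fun t => max (best - t) 0) (gaussianReal m v) := by
  have h : Integrable (fun t : ℝ => t) (gaussianReal m v) :=
    (memLp_id_gaussianReal 1).integrable (by simp)
  exact ((integrable_const best).sub h).sup (integrable_const 0)

/-- If the prediction error is at most `C` standard deviations and the true improvement is at least
`ε`, the expected improvement is bounded below. -/
theorem expectedImprovement_ge {best m f v C ε : ℝ} (hε : 0 ≤ ε) (hv : 0 ≤ v)
    (hf : |f - m| ≤ C * √v) (hbest : ε ≤ best - f) :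
    ε * (gaussianReal 0 1).real (Set.Iic (-C)) ≤ expectedImprovement best m v := by
  -- Markov's inequality at level `ε`. On `t ≤ m - C √v` one has `t ≤ f`, so the improvement is at
  -- least `ε`; the probability of this event is bounded below independently of `v`.
  have h1 := mul_meas_ge_le_integral_of_nonneg
    (μ := gaussianReal m v.toNNReal) (f := fun t => max (best - t) 0)
    (Eventually.of_forall fun t => le_max_right _ _) (integrable_improvement best m _) ε
  refine le_trans ?_ h1
  refine mul_le_mul_of_nonneg_left ?_ hε
  refine (gaussianReal_Iic_ge m hv (-C)).trans (measureReal_mono fun t ht => ?_)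
  simp only [Set.mem_Iic, Set.mem_ofPred_eq] at ht ⊢
  have := (abs_le.1 hf).1
  exact le_max_of_le_left (by nlinarith)

/-- A point `L + 1` below the mean is at most `(L + 1) / √v₀` standard deviations away when `v ≥
v₀`. The extra `1` makes it lie strictly below `b`. -/
theorem gaussianReal_Iio_ge {m v b v₀ L : ℝ} (hv₀ : 0 < v₀) (hv : v₀ ≤ v) (hL : 0 ≤ L)
    (hb : m - L ≤ b) :
    (gaussianReal 0 1).real (Set.Iic (-((L + 1) / √v₀))) ≤
      (gaussianReal m v.toNNReal).real (Set.Iio b) := by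
  refine (gaussianReal_Iic_ge m (hv₀.le.trans hv) _).trans (measureReal_mono fun t ht => ?_)
  simp only [Set.mem_Iic, Set.mem_Iio] at ht ⊢
  have h0 : 0 < √v₀ := Real.sqrt_pos.2 hv₀
  have h1 : L + 1 ≤ √v * ((L + 1) / √v₀) := by
    rw [mul_div_assoc', le_div_iff₀ h0, mul_comm]
    exact mul_le_mul_of_nonneg_right (Real.sqrt_le_sqrt hv) (by linarith)
  linarith

end Gaussian

end TwoStage

namespace TwoStage

/-! ### RKHS error bound for the local models. -/

section LocalModel

open scoped InnerProductSpace in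
/-- Error bound for kriging of a function in the reproducing kernel Hilbert space. -/
theorem RKHSNormLE.abs_sub_localMean_le {Z : Type*} {K : Z → Z → ℝ} {f : Z → ℝ} {C : ℝ}
    (hf : RKHSNormLE K f C) (hK : IsCorrelation K) {P : Finset Z} (hP : P.Nonempty) (z : Z) :
    0 ≤ localVar 1 K P z ∧ |f z - localMean K f P z| ≤ C * √(localVar 1 K P z) := by
  classical
  obtain ⟨H, _, _, _, _, hker, h, hh, hC⟩ := hf
  have : Nonempty P := hP.to_subtype
  obtain ⟨w, -, hmean, hvar, -⟩ := exists_krigingWeights (hK.posDef P) (fun a : P => K z a)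
  let u : Z → H := fun a => RKHS.kerFun H a (1 : ℝ)
  have hu : ∀ a b, ⟪u a, u b⟫_ℝ = K a b := fun a b => by
    rw [RKHS.kerFun_inner, RKHS.kerFun_apply, hker]
    simp
  have huh : ∀ a, ⟪u a, h⟫_ℝ = f a := fun a => by
    rw [RKHS.kerFun_inner, hh]
    simp
  -- Representer of the prediction error functional at `z`: its pairing with `h` is the error, and
  -- its squared norm is the kriging variance for unit process variance.
  set g : H := u z - ∑ a : P, w a • u a with hg
  have hgh : ⟪g, h⟫_ℝ = f z - localMean K f P z := by
    rw [hg, inner_sub_left, sum_inner, huh, localMean, hmean]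
    simp [inner_smul_left, huh, dotProduct]
  have hgg : localVar 1 K P z = ‖g‖ ^ 2 := by
    have h1 : ⟪u z, ∑ a : P, w a • u a⟫_ℝ = w ⬝ᵥ fun a : P => K z a := by
      simp [inner_sum, inner_smul_right, hu, dotProduct]
    have h2 : ‖∑ a : P, w a • u a‖ ^ 2 = w ⬝ᵥ ((Matrix.of fun a b : P => K a b) *ᵥ w) := by
      rw [← real_inner_self_eq_norm_sq, sum_inner]
      simp only [inner_sum, inner_smul_left, inner_smul_right, hu, dotProduct, mulVec, of_apply,
        Finset.mul_sum]
      refine Finset.sum_congr rfl fun a _ => Finset.sum_congr rfl fun b _ => ?_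
      simp
      ring
    rw [hg, norm_sub_sq_real, h1, h2, ← real_inner_self_eq_norm_sq, hu, localVar, hvar, one_mul]
  refine ⟨hgg ▸ sq_nonneg _, ?_⟩
  rw [hgg, Real.sqrt_sq (norm_nonneg _), ← hgh, mul_comm]
  exact (abs_real_inner_le_norm g h).trans (mul_le_mul_of_nonneg_left hC (norm_nonneg _))

theorem RKHSNormLE.nonneg {Z : Type*} {K : Z → Z → ℝ} {f : Z → ℝ} {C : ℝ}
    (hf : RKHSNormLE K f C) : 0 ≤ C := by
  obtain ⟨H, _, _, _, _, -, h, -, hC⟩ := hf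
  exact (norm_nonneg h).trans hC

theorem localVar_eq_mul {Z : Type*} (σ2 : ℝ) (K : Z → Z → ℝ) (P : Finset Z) (z : Z) :
    localVar σ2 K P z = σ2 * localVar 1 K P z := by
  simp [localVar]

end LocalModel

/-! ### The stopping rule of the second-stage search. -/

section Search

variable {Yx Ξ : Type*} {f : Yx → Ξ → ℝ} {ξ : ℕ → Ξ} {Nold Nnew : ℕ} {α : ℝ}
  {σ2 : ℕ → ℝ} {K : ℕ → Yx × Ξ → Yx × Ξ → ℝ} {S S' : LocalState Yx Ξ}

theorem SearchStep.design_subset {N : ℕ} {s2 : ℝ} {R : Yx × Ξ → Yx × Ξ → ℝ}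
    (h : SearchStep f ξ N α s2 R S S') : S.design ⊆ S'.design := by
  classical
  obtain ⟨j, -, -, y, -, ⟨-, rfl⟩ | ⟨-, rfl⟩⟩ := h
  · exact subset_rfl
  · intro z hz
    simp [hz]

theorem design_subset_of_searchSteps {tr : ℕ → LocalState Yx Ξ} {L : ℕ}
    (h : ∀ m < L, SearchStep f ξ Nnew α (σ2 m) (K m) (tr m) (tr (m + 1))) {m : ℕ} (hm : m ≤ L) :
    (tr 0).design ⊆ (tr m).design := by
  induction m with
  | zero => exact subset_rfl
  | succ m ih => exact (ih (by omega)).trans (h m (by omega)).design_subset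

theorem SecondStageSearch.design_subset (h : SecondStageSearch f ξ Nold Nnew α σ2 K S S') :
    S.design ⊆ S'.design := by
  obtain ⟨L, tr, -, -, -, h0, -, hstep, -, rfl⟩ := h
  exact h0.trans (design_subset_of_searchSteps hstep le_rfl)

/-- When the search is over, each scenario has passed the stopping test with its final incumbent at
some step of the search. -/
theorem SecondStageSearch.exists_stopping_state (h : SecondStageSearch f ξ Nold Nnew α σ2 K S S')
    {j : ℕ} (hj : j < Nnew) :
    ∃ m, ∃ T : LocalState Yx Ξ, S.design ⊆ T.design ∧ T.incumbent j = S'.incumbent j ∧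
      ∀ y, T.EI f ξ (σ2 m) (K m) j y ≤ α * |f (S'.incumbent j) (ξ j)| := by
  classical
  obtain ⟨L, tr, hfin0, -, -, h0, -, hstep, hfin, rfl⟩ := h
  -- Only unfinished scenarios are taken up, so the incumbent of a finished one is frozen: the test
  -- it passed earlier still concerns its present incumbent.
  have key : ∀ n ≤ L, j ∈ (tr n).finished →
      ∃ m, ∃ T : LocalState Yx Ξ, S.design ⊆ T.design ∧ T.incumbent j = (tr n).incumbent j ∧
        ∀ y, T.EI f ξ (σ2 m) (K m) j y ≤ α * |f ((tr n).incumbent j) (ξ j)| := by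
    intro n
    induction n with
    | zero => intro _ h; simp [hfin0] at h
    | succ n ih =>
      intro hn hjn
      obtain ⟨i, -, hi, y, hy, ⟨hle, heq⟩ | ⟨-, heq⟩⟩ := hstep n (by omega)
      · rw [heq] at hjn ⊢
        by_cases hij : j = i
        · subst hij
          exact ⟨n, tr n, h0.trans (design_subset_of_searchSteps hstep (by omega)), rfl,
            fun y' => (hy y').trans hle⟩
        · exact ih (by omega) ((Finset.mem_insert.1 hjn).resolve_left hij)
      · rw [heq] at hjn ⊢
        have hij : j ≠ i := fun hij => hi (hij ▸ hjn)
        simpa [Function.update_of_ne hij] using ih (by omega) hjn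
  exact key L le_rfl (by simp [hfin, hj])

/-- A complete search with a sufficiently small threshold makes all optimality gaps small. -/
theorem SecondStageSearch.gap_lt (h : SecondStageSearch f ξ Nold Nnew α σ2 K S S')
    (hS : S.design.Nonempty) (hK : ∀ m, IsCorrelation (K m)) {C : ℝ}
    (hf : ∀ m, RKHSNormLE (K m) (fun z => f z.1 z.2) C) {s : ℝ} (hs : 0 < s)
    (hσ2 : ∀ m, s ≤ σ2 m) {Q : ℝ} (hQ : ∀ y z, |f y z| ≤ Q) (hα : 0 ≤ α) {ε : ℝ} (hε : 0 < ε)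
    (hαε : α * Q < ε * (gaussianReal 0 1).real (Set.Iic (-(C / √s))))
    {j : ℕ} (hj : j < Nnew) (y : Yx) : f (S'.incumbent j) (ξ j) - f y (ξ j) < ε := by
  by_contra! hgap
  obtain ⟨m, T, hT, hinc, hEI⟩ := h.exists_stopping_state hj
  obtain ⟨hv, herr⟩ := (hf m).abs_sub_localMean_le (hK m) (hS.mono hT) (y, ξ j)
  have hs' : 0 < √s := Real.sqrt_pos.2 hs
  have hσ : √s ≤ √(σ2 m) := Real.sqrt_le_sqrt (hσ2 m)
  have hσ0 : 0 ≤ σ2 m := hs.le.trans (hσ2 m)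
  -- The RKHS bound is in units of unit process variance; since `σ2 m ≥ s`, passing to the model's
  -- own standard deviation turns `C` into `C / √s`.
  have hle := expectedImprovement_ge (C := C / √s) (v := localVar (σ2 m) (K m) T.design (y, ξ j))
    hε.le (by rw [localVar_eq_mul]; positivity) (herr.trans ?_) hgap
  · have h1 := hEI y
    rw [LocalState.EI, hinc] at h1
    have h2 := mul_le_mul_of_nonneg_left (hQ (S'.incumbent j) (ξ j)) hα
    linarith
  · rw [localVar_eq_mul (σ2 m), Real.sqrt_mul hσ0, ← mul_assoc, div_mul_eq_mul_div]
    refine mul_le_mul_of_nonneg_right ?_ (Real.sqrt_nonneg _)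
    rw [le_div_iff₀ hs']
    exact mul_le_mul_of_nonneg_left hσ (hf m).nonneg

end Search

end TwoStage

namespace TwoStage

/-! ### Uniform positive definiteness of the correlation forms. -/

section QuadraticForm

variable {X : Type*} [Fintype X]

/-- The quadratic form of a kernel on a finite set. -/
def quadForm (K : X → X → ℝ) (w : X → ℝ) : ℝ :=
  ∑ i, ∑ j, w i * w j * K i j

theorem IsCorrelation.quadForm_pos {K : X → X → ℝ} (hK : IsCorrelation K) {w : X → ℝ}
    (hw : w ≠ 0) : 0 < quadForm K w := by
  have h := ((hK.posDef Finset.univ).submatrix (e := fun x : X => ⟨x, Finset.mem_univ x⟩)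
    fun _ _ h => congrArg Subtype.val h).dotProduct_mulVec_pos hw
  refine h.trans_eq ?_
  simp only [quadForm, dotProduct, mulVec, Finset.mul_sum, submatrix_apply, of_apply, star_trivial]
  exact Finset.sum_congr rfl fun i _ => Finset.sum_congr rfl fun j _ => by ring

/-- Nonnegativity of the form at the weights `e_i + e_j` and `e_i - e_j`, with unit diagonal. -/
theorem IsCorrelation.abs_le_one {K : X → X → ℝ} (hK : IsCorrelation K) (i j : X) :
    |K i j| ≤ 1 := by
  classical
  have key : ∀ s : ℝ, 0 ≤ 1 + 2 * s * K i j + s ^ 2 := fun s => by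
    have h : 0 ≤ quadForm K (Pi.single i 1 + Pi.single j s) := by
      by_cases h0 : (Pi.single i 1 + Pi.single j s : X → ℝ) = 0
      · rw [h0]
        simp [quadForm]
      · exact (hK.quadForm_pos h0).le
    have h2 : quadForm K (Pi.single i 1 + Pi.single j s)
        = K i i + s * K i j + (s * K j i + s * s * K j j) := by
      simp only [quadForm, Pi.add_apply, add_mul, mul_add, Finset.sum_add_distrib]
      simp [Pi.single_apply, ite_mul, mul_ite]
      ring
    rw [h2, hK.diag, hK.diag, hK.symm j i] at h
    linarith
  have h1 := key 1
  have h2 := key (-1)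
  exact abs_le.2 ⟨by linarith, by linarith⟩

/-- A continuous family of kernels that is positive definite at a point is uniformly positive
definite near that point. -/
theorem exists_eventually_quadForm_ge {Θ : Type*} [TopologicalSpace Θ] {K : Θ → X → X → ℝ}
    (hK : ∀ i j, Continuous fun θ => K θ i j) {θ₀ : Θ}
    (hpos : ∀ w, w ≠ 0 → 0 < quadForm (K θ₀) w) :
    ∃ ρ > 0, ∀ᶠ θ in 𝓝 θ₀, ∀ w, ρ * ‖w‖ ^ 2 ≤ quadForm (K θ) w := by
  have hcont : Continuous fun z : Θ × (X → ℝ) => quadForm (K z.1) z.2 := by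
    unfold quadForm
    refine continuous_finsetSum _ fun i _ => continuous_finsetSum _ fun j _ => ?_
    exact (((continuous_apply i).comp continuous_snd).mul
      ((continuous_apply j).comp continuous_snd)).mul ((hK i j).comp continuous_fst)
  have hcomp : IsCompact (Metric.sphere (0 : X → ℝ) 1) := isCompact_sphere _ _
  have hne : ∀ w ∈ Metric.sphere (0 : X → ℝ) 1, 0 < quadForm (K θ₀) w := fun w hw =>
    hpos w (norm_ne_zero_iff.1 (by rw [mem_sphere_zero_iff_norm.1 hw]; exact one_ne_zero))
  obtain ⟨ρ, hρ, hlow⟩ : ∃ ρ > 0, ∀ w ∈ Metric.sphere (0 : X → ℝ) 1, ρ < quadForm (K θ₀) w := by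
    obtain h | h := (Metric.sphere (0 : X → ℝ) 1).eq_empty_or_nonempty
    · exact ⟨1, one_pos, by simp [h]⟩
    · obtain ⟨w, hw, hmin⟩ := hcomp.exists_isMinOn h
        (hcont.comp (Continuous.prodMk_right θ₀)).continuousOn
      exact ⟨quadForm (K θ₀) w / 2, half_pos (hne w hw),
        fun w' hw' => (half_lt_self (hne w hw)).trans_le (hmin hw')⟩
  -- Compactness of the sphere gives one neighbourhood of `θ₀` that serves all unit vectors;
  -- homogeneity then extends the bound to all `w`.
  have hev := hcomp.eventually_forall_of_forall_eventually (x₀ := θ₀)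
    (P := fun θ w => ρ < quadForm (K θ) w)
    fun w hw => (hcont.tendsto (θ₀, w)).eventually_const_lt (hlow w hw)
  refine ⟨ρ, hρ, hev.mono fun θ hθ w => ?_⟩
  by_cases hw : w = 0
  · simp [hw, quadForm]
  have hn : 0 < ‖w‖ := norm_pos_iff.2 hw
  have h1 := hθ (‖w‖⁻¹ • w) (by simp [norm_smul, hn.ne'])
  have h2 : quadForm (K θ) (‖w‖⁻¹ • w) = (‖w‖ ^ 2)⁻¹ * quadForm (K θ) w := by
    simp only [quadForm, Finset.mul_sum, Pi.smul_apply, smul_eq_mul]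
    exact Finset.sum_congr rfl fun i _ => Finset.sum_congr rfl fun j _ => by field_simp
  rw [h2, lt_inv_mul_iff₀ (by positivity), mul_comm] at h1
  exact h1.le

theorem IsCorrelation.quadForm_le {K : X → X → ℝ} (hK : IsCorrelation K) (w : X → ℝ) :
    quadForm K w ≤ (∑ i, |w i|) ^ 2 := by
  rw [sq, Finset.sum_mul_sum, quadForm]
  refine Finset.sum_le_sum fun i _ => Finset.sum_le_sum fun j _ => ?_
  refine (le_abs_self _).trans ?_
  rw [abs_mul, abs_mul]
  exact mul_le_of_le_one_right (by positivity) (hK.abs_le_one i j)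

end QuadraticForm

/-! ### Bounds for global kriging with arbitrary noise variances. -/

section GlobalModel

variable {X : Type*} [Fintype X]

open scoped Classical in
/-- Coefficients of the prediction error at `x` of the linear predictor with weights `w` on `P`. -/
noncomputable def errorCoeff (P : Finset X) (x : X) (w : P → ℝ) : X → ℝ :=
  fun i => (if i = x then 1 else 0) - if h : i ∈ P then w ⟨i, h⟩ else 0

open scoped Classical in
theorem sum_dite_mem (P : Finset X) (g : P → ℝ) :
    ∑ i, (if h : i ∈ P then g ⟨i, h⟩ else 0) = ∑ a, g a := by
  rw [← Finset.sum_subset P.subset_univ (fun i _ hi => by simp [hi]), ← Finset.sum_coe_sort]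
  simp

theorem sum_abs_errorCoeff_le (P : Finset X) (x : X) (w : P → ℝ) :
    ∑ i, |errorCoeff P x w i| ≤ 1 + ∑ a, |w a| := by
  classical
  have h : ∀ i, |errorCoeff P x w i| ≤
      (if i = x then 1 else 0) + if h : i ∈ P then |w ⟨i, h⟩| else 0 := fun i => by
    refine (abs_sub _ _).trans (add_le_add ?_ ?_) <;> split_ifs <;> simp
  refine (Finset.sum_le_sum fun i _ => h i).trans ?_
  rw [Finset.sum_add_distrib, sum_dite_mem P fun a => |w a|]
  simp

theorem quadForm_errorCoeff {K : X → X → ℝ} (hK : IsCorrelation K) (P : Finset X) (x : X)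
    (w : P → ℝ) :
    quadForm K (errorCoeff P x w)
      = 1 - 2 * ∑ a, w a * K x a + ∑ a, ∑ b, w a * w b * K a b := by
  classical
  have hlin : ∀ g : X → ℝ, ∑ i, errorCoeff P x w i * g i = g x - ∑ a, w a * g a := fun g => by
    simp only [errorCoeff, sub_mul, Finset.sum_sub_distrib]
    rw [← sum_dite_mem P fun a => w a * g a]
    simp [dite_mul]
  have h1 : quadForm K (errorCoeff P x w)
      = ∑ i, errorCoeff P x w i * (K i x - ∑ a, w a * K i a) := by
    simp only [quadForm]
    refine Finset.sum_congr rfl fun i _ => ?_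
    rw [← hlin, Finset.mul_sum]
    exact Finset.sum_congr rfl fun j _ => by ring
  rw [h1, hlin, hK.diag]
  simp only [mul_sub, Finset.sum_sub_distrib, Finset.mul_sum]
  have h2 : ∑ a : P, w a * K a x = ∑ a : P, w a * K x a :=
    Finset.sum_congr rfl fun a _ => by rw [hK.symm]
  have h3 : ∀ a b : P, w a * (w b * K a b) = w a * w b * K a b := fun a b => by ring
  rw [h2, ← Finset.mul_sum]
  simp only [h3]
  ring

open scoped Classical in
theorem posDef_add_diagonal {X : Type*} {K : X → X → ℝ} (hK : IsCorrelation K) {t : ℝ} (ht : 0 < t)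
    {P : Finset X} {d : P → ℝ} (hd : ∀ a, 0 ≤ d a) :
    ((Matrix.of fun a b : P => t * K a b) + Matrix.diagonal d).PosDef := by
  have h1 : (t • Matrix.of fun a b : P => K a b).PosDef := (hK.posDef P).smul ht
  have h2 : (t • Matrix.of fun a b : P => K a b) = Matrix.of fun a b : P => t * K a b := by
    ext; simp
  exact (h2 ▸ h1).add_posSemidef (PosSemidef.diagonal fun a => hd a)

open scoped Classical in
-- Splits the error of a linear predictor into a process part, which sees only the error
-- coefficients, and a noise part, monotone in the `|w a|`. This permits comparing predictors
-- without any bound on `d`.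
theorem meanSquaredError_eq {K : X → X → ℝ} (hK : IsCorrelation K) (t : ℝ) {P : Finset X}
    (d : P → ℝ) (x : X) (w : P → ℝ) :
    t - 2 * (w ⬝ᵥ fun a : P => t * K x a)
        + w ⬝ᵥ (((Matrix.of fun a b : P => t * K a b) + Matrix.diagonal d) *ᵥ w)
      = t * quadForm K (errorCoeff P x w) + ∑ a, d a * w a ^ 2 := by
  have h1 : (w ⬝ᵥ fun a : P => t * K x a) = t * ∑ a, w a * K x a := by
    rw [dotProduct, Finset.mul_sum]
    exact Finset.sum_congr rfl fun a _ => by ring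
  have h2 : w ⬝ᵥ ((Matrix.of fun a b : P => t * K a b) *ᵥ w)
      = t * ∑ a, ∑ b, w a * w b * K a b := by
    simp only [dotProduct, mulVec, of_apply, Finset.mul_sum]
    exact Finset.sum_congr rfl fun a _ => Finset.sum_congr rfl fun b _ => by ring
  have h3 : w ⬝ᵥ (Matrix.diagonal d *ᵥ w) = ∑ a, d a * w a ^ 2 := by
    simp only [dotProduct, mulVec_diagonal]
    exact Finset.sum_congr rfl fun a _ => by ring
  rw [add_mulVec, dotProduct_add, h1, h2, h3, quadForm_errorCoeff hK]
  ring

open scoped Classical in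
/-- Kriging with estimation errors of arbitrary size: the predictor is bounded, and the predictive
variance is bounded away from zero outside the design. -/
theorem abs_krigingMean_le_and_krigingVar_ge {K : X → X → ℝ} (hK : IsCorrelation K) {ρ : ℝ}
    (hρ : 0 < ρ) (hKρ : ∀ w, ρ * ‖w‖ ^ 2 ≤ quadForm K w) {t : ℝ} (ht : 0 < t) {P : Finset X}
    (hP : P.Nonempty) {d : P → ℝ} (hd : ∀ a, 0 ≤ d a) {v : P → ℝ} {G : ℝ} (hv : ∀ a, |v a| ≤ G)
    (x : X) :
    |krigingMean ((Matrix.of fun a b : P => t * K a b) + Matrix.diagonal d)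
        (fun a => t * K x a) v| ≤ Fintype.card X * ((1 + 2 / √ρ) * G) ∧
    (x ∉ P → t * ρ ≤ krigingVar ((Matrix.of fun a b : P => t * K a b) + Matrix.diagonal d)
        (fun a => t * K x a) t) := by
  have : Nonempty P := hP.to_subtype
  obtain ⟨w, hw1, hmean, hvar, hmin⟩ :=
    exists_krigingWeights (posDef_add_diagonal hK ht hd) (fun a => t * K x a)
  rw [hmean, hvar]
  simp only [hvar] at hmin
  rw [meanSquaredError_eq hK]
  constructor
  -- The competitor `u` is the normalized positive part of the optimal weights. As `s ≥ 1`, it has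
  -- `|u a| ≤ |w a|`, hence no more noise; optimality of `w` then forces its process part below that
  -- of `u`, which is at most `4` since `u` is a convex combination. This bounds the weights
  -- independently of `d`.
  · set s := ∑ a, max (w a) 0 with hs
    have hs1 : 1 ≤ s := by
      rw [← hw1]
      simp only [dotProduct, Pi.one_apply, one_mul]
      exact Finset.sum_le_sum fun a _ => le_max_left _ _
    have hs0 : 0 < s := one_pos.trans_le hs1
    set u : P → ℝ := fun a => max (w a) 0 / s with hu
    have hu0 : ∀ a, 0 ≤ u a := fun a => div_nonneg (le_max_right _ _) hs0.le
    have hu1 : ∑ a, u a = 1 := by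
      rw [← Finset.sum_div, ← hs, div_self hs0.ne']
    have huw : ∀ a, u a ≤ |w a| := fun a =>
      (div_le_self (le_max_right _ _) hs1).trans (max_le (le_abs_self _) (abs_nonneg _))
    have h1 := hmin t u (by simpa [dotProduct] using hu1)
    rw [meanSquaredError_eq hK, meanSquaredError_eq hK] at h1
    have h2 : ∑ a, d a * u a ^ 2 ≤ ∑ a, d a * w a ^ 2 := Finset.sum_le_sum fun a _ =>
      mul_le_mul_of_nonneg_left (sq_le_sq.2 (by rw [abs_of_nonneg (hu0 a)]; exact huw a)) (hd a)
    have h3 : quadForm K (errorCoeff P x w) ≤ quadForm K (errorCoeff P x u) :=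
      le_of_mul_le_mul_left (by linarith) ht
    have h4 : ∑ i, |errorCoeff P x u i| ≤ 2 := by
      refine (sum_abs_errorCoeff_le P x u).trans ?_
      simp only [abs_of_nonneg (hu0 _), hu1]
      norm_num
    have h5 : quadForm K (errorCoeff P x u) ≤ 2 ^ 2 := (hK.quadForm_le _).trans
      (pow_le_pow_left₀ (Finset.sum_nonneg fun _ _ => abs_nonneg _) h4 2)
    have h6 : ‖errorCoeff P x w‖ ≤ 2 / √ρ := by
      refine abs_le_of_sq_le_sq' ?_ (by positivity) |>.2
      rw [div_pow, Real.sq_sqrt hρ.le, le_div_iff₀ hρ, mul_comm]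
      exact (hKρ _).trans (h3.trans h5)
    have h7 : ∀ a, |w a| ≤ 1 + 2 / √ρ := fun a => by
      have h8 : w a = (if (a : X) = x then 1 else 0) - errorCoeff P x w a := by
        simp [errorCoeff]
      rw [h8]
      refine (abs_sub _ _).trans (add_le_add ?_ ((norm_le_pi_norm _ (a : X)).trans h6))
      split_ifs <;> simp
    have hG : 0 ≤ G := (abs_nonneg _).trans (hv (Classical.arbitrary P))
    calc |w ⬝ᵥ v| ≤ ∑ a, |w a * v a| := Finset.abs_sum_le_sum_abs _ _
      _ ≤ ∑ _a : P, (1 + 2 / √ρ) * G := Finset.sum_le_sum fun a _ => by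
          rw [abs_mul]
          exact mul_le_mul (h7 a) (hv a) (abs_nonneg _) (by positivity)
      _ = Fintype.card P * ((1 + 2 / √ρ) * G) := by simp
      _ ≤ Fintype.card X * ((1 + 2 / √ρ) * G) := by
          refine mul_le_mul_of_nonneg_right ?_ (by positivity)
          exact_mod_cast Fintype.card_subtype_le _
  · intro hx
    -- Off the design no weight can cancel the coefficient `1` at `x`.
    have h1 : errorCoeff P x w x = 1 := by simp [errorCoeff, hx]
    have h2 : 1 ≤ ‖errorCoeff P x w‖ := by
      simpa [h1] using norm_le_pi_norm (errorCoeff P x w) x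
    have h3 : ρ ≤ quadForm K (errorCoeff P x w) :=
      (le_mul_of_one_le_right hρ.le (one_le_pow₀ h2)).trans (hKρ _)
    have h4 : 0 ≤ ∑ a, d a * w a ^ 2 :=
      Finset.sum_nonneg fun a _ => mul_nonneg (hd a) (sq_nonneg _)
    have := mul_le_mul_of_nonneg_left h3 ht.le
    linarith

end GlobalModel

end TwoStage

namespace TwoStage

/-! ### Limits of the threshold and of the number of scenarios. -/

section Parameters

theorem Config.tendsto_threshold (cfg : Config) :
    Tendsto cfg.threshold atTop (𝓝 0) := by
  have h1 : Tendsto (fun t : ℕ => -(((t : ℝ) - 1) / 2)) atTop atBot :=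
    tendsto_neg_atTop_atBot.comp
      ((tendsto_atTop_add_const_right _ (-1) tendsto_natCast_atTop_atTop).atTop_div_const two_pos)
  have h2 := ((tendsto_rpow_atBot_of_base_gt_one cfg.g cfg.one_lt_g).comp h1).const_mul cfg.α0
  rwa [mul_zero] at h2

theorem Config.threshold_nonneg (cfg : Config) (t : ℕ) : 0 ≤ cfg.threshold t :=
  mul_nonneg cfg.α0_pos.le (Real.rpow_nonneg (zero_le_one.trans cfg.one_lt_g.le) _)

theorem Config.eventually_lt_numScenarios (cfg : Config) (j : ℕ) :
    ∀ᶠ t in atTop, j < cfg.numScenarios t := by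
  have h := ((tendsto_pow_atTop_atTop_of_one_lt cfg.one_lt_g).comp
    (tendsto_sub_atTop_nat 1)).eventually_gt_atTop (j : ℝ)
  filter_upwards [h, eventually_ge_atTop 1] with t ht ht1
  rw [Config.numScenarios, if_neg (by omega), Nat.lt_ceil]
  have h1 : (1 : ℝ) ≤ cfg.n0 := by exact_mod_cast cfg.n0_pos
  have h2 : 0 ≤ cfg.g ^ (t - 1) := pow_nonneg (zero_le_one.trans cfg.one_lt_g.le) _
  exact ht.trans_le (le_mul_of_one_le_left h2 h1)

end Parameters

/-- The factor `⊤` encodes uniformity over the search steps. -/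
theorem eventually_forall_of_eventually_prod_top {P : ℕ × ℕ → Prop}
    (h : ∀ᶠ i in (atTop : Filter ℕ) ×ˢ ⊤, P i) : ∀ᶠ k in atTop, ∀ m, P (k, m) := by
  rw [← principal_univ, eventually_prod_principal_iff] at h
  simpa using h

/-! ### Visit counts and elementary bounds along a run. -/

namespace RunData

variable {X : Type*} {Y : X → Type*} {Ξ Φ Ψ : Type*} {cfg : Config} {Ω : Type*}

theorem visits_succ_of_mem (A : RunData X Y Ξ Φ Ψ cfg Ω) {k : ℕ} {x : X} {ω : Ω}
    (h : x ∈ A.D k ω) : A.visits (k + 1) x ω = A.visits k x ω + 1 := by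
  simp [visits, Finset.range_add_one, Finset.filter_insert, h]

theorem visits_succ_of_notMem (A : RunData X Y Ξ Φ Ψ cfg Ω) {k : ℕ} {x : X} {ω : Ω}
    (h : x ∉ A.D k ω) : A.visits (k + 1) x ω = A.visits k x ω := by
  simp [visits, Finset.range_add_one, Finset.filter_insert, h]

theorem monotone_visits (A : RunData X Y Ξ Φ Ψ cfg Ω) (x : X) (ω : Ω) :
    Monotone fun k => A.visits k x ω :=
  monotone_nat_of_le_succ fun k => by
    by_cases h : x ∈ A.D k ω
    · simp [A.visits_succ_of_mem h]
    · simp [A.visits_succ_of_notMem h]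

theorem tendsto_visits (A : RunData X Y Ξ Φ Ψ cfg Ω) {x : X} {ω : Ω}
    (h : ∃ᶠ k in atTop, x ∈ A.D k ω) : Tendsto (fun k => A.visits k x ω) atTop atTop := by
  refine tendsto_atTop_atTop_of_monotone (A.monotone_visits x ω) fun b => ?_
  induction b with
  | zero => exact ⟨0, Nat.zero_le _⟩
  | succ b ih =>
    obtain ⟨a, ha⟩ := ih
    obtain ⟨k, hk, hx⟩ := frequently_atTop.1 h a
    refine ⟨k + 1, ?_⟩
    rw [A.visits_succ_of_mem hx]
    exact Nat.add_le_add_right (ha.trans (A.monotone_visits x ω hk)) 1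

variable [MeasurableSpace Ξ]

theorem abs_Gbar_le (A : RunData X Y Ξ Φ Ψ cfg Ω) (p : Problem X Y Ξ) (k : ℕ) (x : X) (ω : Ω) :
    |A.Gbar p k x ω| ≤ cfg.Gmax :=
  abs_le.2 ⟨le_max_left _ _,
    max_le ((neg_nonpos.2 cfg.Gmax_pos.le).trans cfg.Gmax_pos.le) (min_le_left _ _)⟩

theorem V_nonneg (A : RunData X Y Ξ Φ Ψ cfg Ω) (p : Problem X Y Ξ) (k : ℕ) (x : X) (ω : Ω) :
    0 ≤ A.V p k x ω := by
  have h : (2 : ℝ) ≤ cfg.T := by exact_mod_cast cfg.two_le_T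
  exact div_nonneg (Finset.sum_nonneg fun _ _ => sq_nonneg _) (by linarith)

variable [TopologicalSpace Φ] [TopologicalSpace Ψ] [Fintype X] {mΩ : MeasurableSpace Ω} {A : RunData X Y Ξ Φ Ψ cfg Ω} {p : Problem X Y Ξ}
  {M : Models X Y Ξ Φ Ψ} {μ : Measure Ω} {𝓕 : Filtration ℕ mΩ}

/-! ### Vanishing gaps at points visited infinitely often. -/

section SecondStage

theorem IsRun.design_nonempty (hA : A.IsRun p M μ 𝓕) (k : ℕ) (x : X) (ω : Ω) :
    (A.loc k x ω).design.Nonempty := by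
  induction k with
  | zero => exact hA.loc_zero x ω
  | succ k ih =>
    by_cases h : x ∈ A.D k ω
    · exact ih.mono (hA.search k ω x h).design_subset
    · rwa [hA.loc_succ k ω x h]

/-- At a point visited infinitely often the optimality gaps of all generated scenarios become
small. -/
theorem IsRun.eventually_gap_lt [∀ x, Fintype (Y x)] [∀ x, Nonempty (Y x)]
    (hA : A.IsRun p M μ 𝓕) {x : X} {ω : Ω} {C Q : ℝ} (hQ : ∀ y ξ, |p.q x y ξ| ≤ Q)
    (hRKHS : ∀ᶠ θ in 𝓝 (M.φ x), RKHSNormLE (M.R x θ) (fun z => p.q x z.1 z.2) C)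
    (hσ2 : 0 < M.σ2 x)
    (hσ2hat : Tendsto (fun i : ℕ × ℕ => A.σ2hat i.1 x i.2 ω) (atTop ×ˢ ⊤) (𝓝 (M.σ2 x)))
    (hφhat : Tendsto (fun i : ℕ × ℕ => A.φhat i.1 x i.2 ω) (atTop ×ˢ ⊤) (𝓝 (M.φ x)))
    (hx : ∃ᶠ k in atTop, x ∈ A.D k ω) {ε : ℝ} (hε : 0 < ε) :
    ∀ᶠ k in atTop, ∀ j < A.N k x ω, A.gap p k x j ω < ε := by
  have hgap : ∀ k j, (∀ y, p.q x ((A.loc k x ω).incumbent j) (A.ξ x j ω)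
      - p.q x y (A.ξ x j ω) < ε) → A.gap p k x j ω < ε := fun k j h => by
    obtain ⟨y, hy⟩ := exists_eq_ciInf_of_finite (f := fun y => p.q x y (A.ξ x j ω))
    rw [gap, ← hy]
    exact h y
  -- Eventually the variance estimates exceed half the true variance, so this one constant serves
  -- all late searches.
  set γ := (gaussianReal 0 1).real (Set.Iic (-(C / √(M.σ2 x / 2))))
  have hγ : 0 < ε * γ := mul_pos hε (gaussianReal_Iic_pos _)
  have hthr : ∀ᶠ k in atTop, cfg.threshold (A.visits (k + 1) x ω) * Q < ε * γ := by
    have h := (cfg.tendsto_threshold.comp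
      ((A.tendsto_visits hx).comp (tendsto_add_atTop_nat 1))).mul_const Q
    rw [zero_mul] at h
    exact h.eventually_lt_const hγ
  have hσ := eventually_forall_of_eventually_prod_top
    (hσ2hat.eventually_const_lt (half_lt_self hσ2))
  have hφ := eventually_forall_of_eventually_prod_top (hφhat.eventually hRKHS)
  obtain ⟨k₀, hk₀⟩ := eventually_atTop.1 (hthr.and (hσ.and hφ))
  have hsearch : ∀ k ≥ k₀, x ∈ A.D k ω → ∀ j < A.N (k + 1) x ω, A.gap p (k + 1) x j ω < ε :=
    fun k hk hxk j hj => hgap _ _ <|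
      (hA.search k ω x hxk).gap_lt (hA.design_nonempty k x ω) (fun m => M.isCorrelation_R x _)
        (hk₀ k hk).2.2 (half_pos hσ2) (fun m => ((hk₀ k hk).2.1 m).le) hQ (cfg.threshold_nonneg _)
        hε (hk₀ k hk).1 hj
  obtain ⟨k₁, hk₁, hxk₁⟩ := frequently_atTop.1 hx k₀
  refine eventually_atTop.2 ⟨k₁ + 1, fun k hk => ?_⟩
  -- Starting from the first state after a late visit, each iteration either searches again,
  -- covering old and new scenarios alike, or changes nothing at `x`.
  induction k, hk using Nat.le_induction with
  | base => exact hsearch k₁ hk₁ hxk₁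
  | succ k hk ih =>
    by_cases h : x ∈ A.D k ω
    · exact hsearch k (by omega) h
    · simpa only [N, gap, A.visits_succ_of_notMem h, hA.loc_succ k ω x h] using ih

end SecondStage

/-! ### Every first-stage point is visited infinitely often. -/

section FirstStage

theorem IsRun.visited_nonempty (hA : A.IsRun p M μ 𝓕) (k : ℕ) (ω : Ω) :
    (A.visited (k + 1) ω).Nonempty := by
  obtain ⟨x, hx⟩ := hA.D_zero ω
  refine ⟨x, ?_⟩
  have h1 := A.monotone_visits x ω (Nat.succ_le_succ (Nat.zero_le k))
  have h2 := A.visits_succ_of_mem hx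
  simp only [visited, Finset.mem_filter, Finset.mem_univ, true_and]
  simp only [Nat.succ_eq_add_one] at h1
  omega

/-- A lower bound for the probability of improvement that depends on the global metamodel only
through its process variance and the smallest value of its correlation form. -/
theorem IsRun.probBetter_ge (hA : A.IsRun p M μ 𝓕) {k : ℕ} {ω : Ω} {t ρ : ℝ} (ht : 0 < t)
    (hτ : t ≤ A.τ2hat k ω) (hρ : 0 < ρ)
    (hr : ∀ w, ρ * ‖w‖ ^ 2 ≤ quadForm (M.r (A.ψhat k ω)) w) (x : X) :
    (gaussianReal 0 1).real (Set.Iic (-((Fintype.card X * ((1 + 2 / √ρ) * cfg.Gmax) + cfg.Gmax + 1)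
        / √(min (t * ρ) cfg.varMin)))) ≤ A.probBetter p M k ω x := by
  have hne := hA.visited_nonempty k ω
  have : Nonempty (A.visited (k + 1) ω) := hne.to_subtype
  obtain ⟨hmean, hvar⟩ := abs_krigingMean_le_and_krigingVar_ge (M.isCorrelation_r (A.ψhat k ω))
    hρ hr (ht.trans_le hτ) hne (d := fun a => A.V p k a ω) (fun a => A.V_nonneg p k a ω)
    (v := fun a => A.Gbar p k a ω) (fun a => A.abs_Gbar_le p k a ω) x
  have hG := cfg.Gmax_pos
  -- Here `L` is the bound on the predictor plus `Gmax`, as the best estimate is at least `-Gmax`.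
  -- The variance is at least `varMin` at visited points and `t * ρ` elsewhere.
  refine gaussianReal_Iio_ge (lt_min (mul_pos ht hρ) cfg.varMin_pos) ?_ (by positivity) ?_
  · rw [globalVar]
    split_ifs with h
    · exact (min_le_right _ _).trans (le_max_right _ _)
    · exact (min_le_left _ _).trans ((mul_le_mul_of_nonneg_right hτ hρ.le).trans (hvar h))
  · have h1 : -cfg.Gmax ≤ A.bestGbar p k ω :=
      le_ciInf fun a => (abs_le.1 (A.abs_Gbar_le p k a ω)).1
    have h2 : A.globalMean p M k ω x ≤ Fintype.card X * ((1 + 2 / √ρ) * cfg.Gmax) :=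
      (abs_le.1 hmean).2
    linarith

theorem probBetter_le_one (A : RunData X Y Ξ Φ Ψ cfg Ω) (p : Problem X Y Ξ)
    (M : Models X Y Ξ Φ Ψ) (k : ℕ) (ω : Ω) (x : X) : A.probBetter p M k ω x ≤ 1 :=
  measureReal_le_one

/-- The normalizing sum has `Fintype.card X` terms, each at most `1`. -/
theorem samplingDist_ge {k : ℕ} {ω : Ω} {c : ℝ} (hc : 0 < c)
    (h : ∀ x, c ≤ A.probBetter p M k ω x) (x : X) :
    c / Fintype.card X ≤ A.samplingDist p M k ω x := by
  have h1 : ∑ x', A.probBetter p M k ω x' ≤ Fintype.card X := by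
    simpa using Finset.sum_le_sum fun x' (_ : x' ∈ Finset.univ) => A.probBetter_le_one p M k ω x'
  have h2 : 0 < ∑ x', A.probBetter p M k ω x' :=
    Finset.sum_pos (fun x' _ => hc.trans_le (h x')) ⟨x, Finset.mem_univ x⟩
  exact div_le_div₀ (hc.le.trans (h x)) (h x) h2 h1

/-- With probability one, every first-stage point is visited infinitely often. -/
theorem IsRun.ae_frequently_mem_D [IsProbabilityMeasure μ] (hA : A.IsRun p M μ 𝓕)
    (hτ2 : 0 < M.τ2)
    (hτ2hat : ∀ᵐ ω ∂μ, Tendsto (fun k => A.τ2hat k ω) atTop (𝓝 M.τ2))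
    (hψhat : ∀ᵐ ω ∂μ, Tendsto (fun k => A.ψhat k ω) atTop (𝓝 M.ψ)) (x : X) :
    ∀ᵐ ω ∂μ, ∃ᶠ k in atTop, x ∈ A.D k ω := by
  obtain ⟨ρ, hρ, hev⟩ := exists_eventually_quadForm_ge M.continuous_r
    (fun w hw => (M.isCorrelation_r M.ψ).quadForm_pos hw)
  set c := (gaussianReal 0 1).real
    (Set.Iic (-((Fintype.card X * ((1 + 2 / √ρ) * cfg.Gmax) + cfg.Gmax + 1)
        / √(min (M.τ2 / 2 * ρ) cfg.varMin))))
  have hc : 0 < c := gaussianReal_Iic_pos _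
  have hcard : (0 : ℝ) < Fintype.card X := by
    exact_mod_cast Fintype.card_pos_iff.2 ⟨x⟩
  -- All `s` draws equal `x`: by conditional independence this has conditional probability
  -- `samplingDist ^ s`. The index is shifted to make `E k` measurable for `𝓕 k`, and `0 < k`
  -- discards the truncated `0 - 1`.
  let E : ℕ → Set Ω := fun k => {ω | 0 < k ∧ ∀ i, A.draw (k - 1) i ω = x}
  have hE : ∀ k, MeasurableSet[𝓕 k] (E k) := by
    rintro (_ | k)
    · simp [E]
    · have h : E (k + 1) = ⋂ i, {ω | A.draw k i ω = x} := by ext; simp [E]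
      rw [h]
      exact MeasurableSet.iInter fun i => hA.measurable_draw k i x
  have hlaw : ∀ᵐ ω ∂μ, ∀ k, (μ[(E (k + 1)).indicator (1 : Ω → ℝ) | 𝓕 k]) ω
      = A.samplingDist p M k ω x ^ cfg.s := by
    refine ae_all_iff.2 fun k => ?_
    filter_upwards [hA.law_draw k fun _ => x] with ω hω
    have h : E (k + 1) = {ω | ∀ i, A.draw k i ω = x} := by ext; simp [E]
    rw [h]
    refine hω.trans ?_
    simp
  -- Lévy's Borel–Cantelli lemma: `E` occurs infinitely often exactly when the conditional
  -- probabilities have a divergent sum, which holds as they are eventually bounded below.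
  filter_upwards [ae_mem_limsup_atTop_iff μ hE, hlaw, hτ2hat, hψhat] with ω hBC hω hτ hψ
  have hlim : ω ∈ limsup E atTop := by
    rw [hBC]
    simp only [hω]
    obtain ⟨k₀, hk₀⟩ := eventually_atTop.1
      ((hτ.eventually_const_lt (half_lt_self hτ2)).and (hψ.eventually hev))
    have hnn : ∀ k, 0 ≤ A.samplingDist p M k ω x := fun k =>
      div_nonneg measureReal_nonneg (Finset.sum_nonneg fun _ _ => measureReal_nonneg)
    refine not_summable_iff_tendsto_nat_atTop_of_nonneg (fun k => pow_nonneg (hnn k) _) |>.1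
      fun hsum => ?_
    have hpos : 0 < (c / Fintype.card X) ^ cfg.s := pow_pos (div_pos hc hcard) _
    obtain ⟨k, hk, hlt⟩ := ((eventually_ge_atTop k₀).and
      (hsum.tendsto_atTop_zero.eventually_lt_const hpos)).exists
    refine hlt.not_ge (pow_le_pow_left₀ (div_pos hc hcard).le (samplingDist_ge hc (fun x' => ?_) x) _)
    exact hA.probBetter_ge (half_pos hτ2) (hk₀ k hk).1.le hρ (hk₀ k hk).2 x'
  refine ((mem_limsup_iff_frequently_mem (s := E)).1 hlim).mono fun k hk => ?_
  obtain ⟨h0, hk⟩ := hk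
  obtain ⟨k, rfl⟩ := Nat.exists_eq_succ_of_ne_zero h0.ne'
  rw [Nat.succ_eq_add_one, hA.D_succ]
  simpa using ⟨⟨0, cfg.s_pos⟩, hk ⟨0, cfg.s_pos⟩⟩

end FirstStage

end RunData

end TwoStage

theorem lemma2 {X : Type*} [Fintype X] {Y : X → Type*} [∀ x, Fintype (Y x)] [∀ x, Nonempty (Y x)]
    {Ξ : Type*} [MeasurableSpace Ξ] {Φ Ψ : Type*} [TopologicalSpace Φ] [TopologicalSpace Ψ]
    {Ω : Type*} {mΩ : MeasurableSpace Ω} (μ : Measure Ω) [IsProbabilityMeasure μ]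
    (𝓕 : Filtration ℕ mΩ)
    (p : TwoStage.Problem X Y Ξ) (M : TwoStage.Models X Y Ξ Φ Ψ) (cfg : TwoStage.Config)
    (A : TwoStage.RunData X Y Ξ Φ Ψ cfg Ω) (hA : A.IsRun p M μ 𝓕)
    -- bounded response, and bounded norm in the RKHS of the correlation function
    (C : ℝ) (hbdd : ∀ x y ξ, |p.c0 x + p.q x y ξ| ≤ C)
    (hRKHS : ∀ x, ∀ᶠ θ in 𝓝 (M.φ x),
      TwoStage.RKHSNormLE (M.R x θ) (fun z => p.q x z.1 z.2) C)
    -- positive process variances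
    (hσ2 : ∀ x, 0 < M.σ2 x) (hτ2 : 0 < M.τ2)
    -- consistent parameter estimates (for the local models uniformly over the search steps `m`)
    (hσ2hat : ∀ᵐ ω ∂μ, ∀ x,
      Tendsto (fun i : ℕ × ℕ => A.σ2hat i.1 x i.2 ω) (atTop ×ˢ ⊤) (𝓝 (M.σ2 x)))
    (hφhat : ∀ᵐ ω ∂μ, ∀ x,
      Tendsto (fun i : ℕ × ℕ => A.φhat i.1 x i.2 ω) (atTop ×ˢ ⊤) (𝓝 (M.φ x)))
    (hτ2hat : ∀ᵐ ω ∂μ, Tendsto (fun k => A.τ2hat k ω) atTop (𝓝 M.τ2))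
    (hψhat : ∀ᵐ ω ∂μ, Tendsto (fun k => A.ψhat k ω) atTop (𝓝 M.ψ)) :
    ∀ x, ∀ᵐ ω ∂μ,
      (∀ j, (∀ᶠ k in atTop, j < A.N k x ω) ∧
        Tendsto (fun k => A.gap p k x j ω) atTop (𝓝 0)) ∧
      (∀ ε > 0, ∀ᶠ k in atTop, ∀ j < A.N k x ω, A.gap p k x j ω < ε) := by
  intro x
  -- The stopping test is relative to `|q|` alone, so `c0 x` has to be removed from the bound.
  have hQ : ∀ y ξ, |p.q x y ξ| ≤ C + |p.c0 x| := fun y ξ => by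
    have h := abs_sub (p.c0 x + p.q x y ξ) (p.c0 x)
    rw [add_sub_cancel_left] at h
    exact h.trans (by gcongr; exact hbdd x y ξ)
  filter_upwards [hA.ae_frequently_mem_D hτ2 hτ2hat hψhat x, hσ2hat, hφhat] with ω hx hσ hφ
  have hgap : ∀ ε > 0, ∀ᶠ k in atTop, ∀ j < A.N k x ω, A.gap p k x j ω < ε := fun ε hε =>
    hA.eventually_gap_lt hQ (hRKHS x) (hσ2 x) (hσ x) (hφ x) hx hε
  refine ⟨fun j => ?_, hgap⟩
  have hj : ∀ᶠ k in atTop, j < A.N k x ω :=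
    (A.tendsto_visits hx).eventually (cfg.eventually_lt_numScenarios j)
  refine ⟨hj, tendsto_order.2 ⟨fun a ha => Eventually.of_forall fun k => ha.trans_le ?_,
    fun ε hε => (hj.and (hgap ε hε)).mono fun k hk => hk.2 j hk.1⟩⟩
  exact sub_nonneg.2 (ciInf_le (Set.finite_range _).bddBelow _)
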